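/- For a finite connected graph $G$ with distance $d_G$, let $D(G)=(d_G(u,v))_{u,v\in V(G)}$ be its distance matrix, let $WI(G)=\frac12\sum_{u,v\in V(G)}d_G(u,v)$ be its Wiener index, and let $DSR(G)$, the distance spectral radius, be the largest eigenvalue of $D(G)$. The degree sequence of $G$ is the list of its vertex degrees in ascending order. Let $\mathbf d=(d_1\le\dots\le d_n)$ be the degree sequence of some tree on $n$ vertices, and let $\mathcal T(\mathbf d)$ be the set of all trees (on a fixed set of $n$ vertices) with degree sequence $\mathbf d$. The BFS-tree (greedy tree) $BFS(\mathbf d)$ is the tree with vertices $v_0,v_1,\dots,v_{n-1}$, numbered level by level from the root $v_0$ and from left to right inside each level, built as follows: $v_0,v_1,\dots$ are processed in this order, $v_0$ is joined to the next $d_n$ unused vertices (its children), and each $v_i$ with $i\ge1$ is joined to the next $d_{n-i}-1$ unused vertices (its children), so that $v_i$ has degree $d_{n-i}$. Then $DSR$ attains its minimum over $\mathcal T(\mathbf d)$, and every tree $T^*\in\mathcal T(\mathbf d)$ that minimizes $DSR$ over $\mathcal T(\mathbf d)$ satisfies $$\frac{2}{n}\,WI(BFS(\mathbf d))\;\le\;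 DSR(T^*)\;\le\; DSR(BFS(\mathbf d)).$$ -/

import Mathlib

/-- The distance matrix `D(G) = (d_G(u,v))` of a finite graph. -/
noncomputable def distanceMatrix {V : Type*} (G : SimpleGraph V) : Matrix V V ℝ :=
  Matrix.of fun u v => (G.dist u v : ℝ)

/-- The Wiener index: one half of the sum of all entries of the distance matrix. -/
noncomputable def wienerIndex {V : Type*} [Fintype V] (G : SimpleGraph V) : ℝ :=
  (1 / 2) * ∑ u, ∑ v, distanceMatrix G u v

/-- The distance spectral radius: the largest eigenvalue of the distance matrix. -/
noncomputable def distanceSpectralRadius {V : Type*} [Fintype V] (G : SimpleGraph V) : ℝ :=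
  sSup {μ : ℝ | Module.End.HasEigenvalue (distanceMatrix G).mulVecLin μ}

/-- On a nonempty vertex set, the supremum above is a maximum, so it is never a junk value. -/
theorem isGreatest_distanceSpectralRadius {V : Type*} [Fintype V] [Nonempty V]
    (G : SimpleGraph V) :
    IsGreatest {μ : ℝ | Module.End.HasEigenvalue (distanceMatrix G).mulVecLin μ}
      (distanceSpectralRadius G) := by
  classical
  have hA : (distanceMatrix G).IsHermitian := by
    ext u v
    simp [distanceMatrix, SimpleGraph.dist_comm]
  have hfin : {μ : ℝ | Module.End.HasEigenvalue (distanceMatrix G).mulVecLin μ}.Finite :=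
    Module.End.finite_hasEigenvalue _
  have hne : {μ : ℝ | Module.End.HasEigenvalue (distanceMatrix G).mulVecLin μ}.Nonempty := by
    obtain ⟨i⟩ := ‹Nonempty V›
    refine ⟨hA.eigenvalues i, ?_⟩
    refine Module.End.hasEigenvalue_of_hasEigenvector
      (x := (hA.eigenvectorBasis i).ofLp) ⟨?_, ?_⟩
    · rw [Module.End.mem_eigenspace_iff]
      exact hA.mulVec_eigenvectorBasis i
    · intro h
      apply hA.eigenvectorBasis.orthonormal.ne_zero i
      ext j
      exact congrFun h j
  exact ⟨hne.csSup_mem hfin, fun x hx => le_csSup hfin.bddAbove hx⟩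

open Classical in
/-- The degree sequence of a finite graph: its vertex degrees in ascending order. -/
noncomputable def degreeSequence {V : Type*} [Fintype V] (G : SimpleGraph V) : List ℕ :=
  (Finset.univ.val.map fun v => G.degree v).sort (· ≤ ·)

/-- The trees on the vertex set `V` whose degree sequence is `d`. -/
def treesWithDegreeSequence (V : Type*) [Fintype V] (d : List ℕ) : Set (SimpleGraph V) :=
  {T | T.IsTree ∧ degreeSequence T = d}

/-- The number of children that vertex `i` receives in the BFS-tree of the ascending sequence `d`.
Vertices are numbered `0, 1, 2, …` level by level and from left to right inside a level,
and vertex `i` gets the `i`-th largest degree (counting from `0`). The root `0` has as many children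
as its degree, and every other vertex has one neighbour that is not a child, its parent. -/
def bfsChildCount (d : List ℕ) (i : ℕ) : ℕ :=
  if i = 0 then d.reverse.getD 0 0 else d.reverse.getD i 0 - 1

/-- The number of the first vertex still unused when vertex `i` is about to receive its children:
the root and all the children of the vertices `0, …, i - 1` have been used. -/
def bfsFirstChild (d : List ℕ) (i : ℕ) : ℕ :=
  1 + ∑ j ∈ Finset.range i, bfsChildCount d j

/-- The BFS-tree (greedy tree) of the ascending degree sequence `d`: the vertices are processed in
the order `0, 1, 2, …`, and vertex `i` is joined to the next `bfsChildCount d i` unused vertices. -/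
def bfsTree (d : List ℕ) : SimpleGraph (Fin d.length) :=
  SimpleGraph.fromRel fun i j =>
    bfsFirstChild d (i : ℕ) ≤ (j : ℕ) ∧ (j : ℕ) < bfsFirstChild d ((i : ℕ) + 1)

/-! The upper bound holds because a relabelled copy of the BFS-tree belongs to the class over which
`T` is minimal. For the lower bound, the Rayleigh quotient of the distance matrix of `T` at the
all-ones vector is `2/n` times the Wiener index of `T`, so it suffices that the BFS-tree minimizes
the Wiener index (`SimpleGraph.IsTree.wienerIndex_bfsTree_le`).

Root a tree and let `s(v)` be the size of the subtree at `v`. Deleting the edge above `v` splits the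
tree into parts of sizes `s(v)` and `n - s(v)`, so the Wiener index is `∑ s(v) (n - s(v))`
(`wienerIndex_eq`). With a median as root, `s(v) ≤ n/2` for every other `v`.

The combinatorial core is `IsTreeSequence.sum_subtreeSize_le`. For a set `A` containing the root,
the sum of `s` outside `A` counts the pairs `(u, k)` with `p^[k] u ∉ A`. The number of vertices with
parent in a set `B` containing the root is `∑_{v ∈ B} deg v + 2 - |B|`, where the root counts as its
own parent. It is largest when `B` carries the largest degrees, and the initial segments of the
BFS-tree attain this maximum at every iteration.

Hence, if `x` lists the sizes in the given tree in descending order and `y` those in the BFS-tree in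
BFS order, each tail sum of `x - y` omitting the root is nonnegative. By concavity `x(n-x) - y(n-y)
≥ (n-2x)(x-y)`, and since the weights `n - 2x` are nonnegative and ascending off the root, summation
by parts finishes the comparison. -/

/-! ### Rooted trees described by parent maps -/

/-- The parent map `p` with root `ρ` generates the graph `G`, and `h` decreases towards the root. -/
structure SimpleGraph.IsRootedBy {V : Type*} (G : SimpleGraph V) (ρ : V) (p : V → V) (h : V → ℕ) :
    Prop where
  parent_root : p ρ = ρ
  height_lt : ∀ v, v ≠ ρ → h (p v) < h v
  adj_iff : ∀ u v, G.Adj u v ↔ u ≠ v ∧ (p u = v ∨ p v = u)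

open Classical in
/-- The ancestors of `u`, including `u` itself. -/
noncomputable def ancestors {V : Type*} [Fintype V] (p : V → V) (u : V) : Finset V :=
  Finset.univ.filter fun v => ∃ k, p^[k] u = v

open Classical in
/-- The size of the subtree hanging from `v`. -/
noncomputable def subtreeSize {V : Type*} [Fintype V] (p : V → V) (v : V) : ℕ :=
  (Finset.univ.filter fun u => v ∈ ancestors p u).card

namespace SimpleGraph.IsRootedBy

open Classical

variable {V : Type*} [Fintype V] {G : SimpleGraph V} {ρ : V} {p : V → V} {h : V → ℕ}

theorem mem_ancestors {u v : V} : v ∈ ancestors p u ↔ ∃ k, p^[k] u = v := by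
  simp [ancestors]

theorem self_mem_ancestors (u : V) : u ∈ ancestors p u := mem_ancestors.2 ⟨0, rfl⟩

theorem ancestors_eq_insert (u : V) : ancestors p u = insert u (ancestors p (p u)) := by
  ext v
  simp only [Finset.mem_insert, mem_ancestors]
  constructor
  · rintro ⟨k, rfl⟩
    cases k with
    | zero => exact Or.inl rfl
    | succ k => exact Or.inr ⟨k, rfl⟩
  · rintro (rfl | ⟨k, rfl⟩)
    · exact ⟨0, rfl⟩
    · exact ⟨k + 1, rfl⟩

omit [Fintype V] in
theorem iterate_root (H : G.IsRootedBy ρ p h) (k : ℕ) : p^[k] ρ = ρ :=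
  Function.iterate_fixed H.parent_root k

omit [Fintype V] in
theorem height_parent_le (H : G.IsRootedBy ρ p h) (v : V) : h (p v) ≤ h v := by
  by_cases hv : v = ρ
  · rw [hv, H.parent_root]
  · exact (H.height_lt v hv).le

theorem height_le_of_mem_ancestors (H : G.IsRootedBy ρ p h) {u v : V} (hv : v ∈ ancestors p u) :
    h v ≤ h u := by
  obtain ⟨k, rfl⟩ := mem_ancestors.1 hv
  induction k with
  | zero => exact le_rfl
  | succ k ih =>
    rw [Function.iterate_succ_apply']
    exact (H.height_parent_le _).trans (ih (mem_ancestors.2 ⟨k, rfl⟩))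

theorem notMem_ancestors_parent (H : G.IsRootedBy ρ p h) {u : V} (hu : u ≠ ρ) :
    u ∉ ancestors p (p u) := fun hm =>
  absurd (H.height_le_of_mem_ancestors hm) (not_le.2 (H.height_lt u hu))

theorem ancestors_root (H : G.IsRootedBy ρ p h) : ancestors p ρ = {ρ} := by
  ext v
  simp [mem_ancestors, H.iterate_root, eq_comm]

theorem height_lt_of_mem_ancestors (H : G.IsRootedBy ρ p h) {u v : V} (hv : v ∈ ancestors p u)
    (huv : u ≠ v) : h v < h u := by
  have hu : u ≠ ρ := by
    rintro rfl
    rw [H.ancestors_root, Finset.mem_singleton] at hv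
    exact huv hv.symm
  rw [ancestors_eq_insert, Finset.mem_insert] at hv
  exact (H.height_le_of_mem_ancestors (hv.resolve_left huv.symm)).trans_lt (H.height_lt u hu)

omit [Fintype V] in
theorem iterate_height (H : G.IsRootedBy ρ p h) (N : ℕ) (u : V) (hN : h u ≤ N) :
    p^[N] u = ρ := by
  induction N generalizing u with
  | zero =>
    by_contra hu
    exact absurd (H.height_lt u hu) (by omega)
  | succ N ih =>
    by_cases hu : u = ρ
    · rw [hu, H.iterate_root]
    · rw [Function.iterate_succ_apply]
      exact ih _ (by have := H.height_lt u hu; omega)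

theorem root_mem_ancestors (H : G.IsRootedBy ρ p h) (u : V) : ρ ∈ ancestors p u :=
  mem_ancestors.2 ⟨_, H.iterate_height _ u le_rfl⟩

omit [Fintype V] in
theorem adj_parent (H : G.IsRootedBy ρ p h) {u : V} (hu : u ≠ ρ) : G.Adj u (p u) := by
  refine (H.adj_iff _ _).2 ⟨fun e => ?_, Or.inl rfl⟩
  have := H.height_lt u hu
  rw [← e] at this
  exact lt_irrefl _ this

omit [Fintype V] in
theorem reachable_root (H : G.IsRootedBy ρ p h) (u : V) : G.Reachable u ρ := by
  induction hn : h u using Nat.strong_induction_on generalizing u with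
  | _ n ih =>
    by_cases hu : u = ρ
    · rw [hu]
    · exact (H.adj_parent hu).reachable.trans (ih _ (hn ▸ H.height_lt u hu) _ rfl)

omit [Fintype V] in
theorem connected (H : G.IsRootedBy ρ p h) : G.Connected :=
  { preconnected := fun u v => (H.reachable_root u).trans (H.reachable_root v).symm
    nonempty := ⟨ρ⟩ }

/-- Every edge has the form `s(v, p v)` with `v ≠ ρ`, so a connected graph on `n` vertices has at
most `n - 1` edges here. -/
theorem isTree (H : G.IsRootedBy ρ p h) : G.IsTree := by
  rw [isTree_iff_connected_and_card]
  refine ⟨H.connected, le_antisymm ?_ H.connected.card_vert_le_card_edgeSet_add_one⟩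
  have hsub : G.edgeSet ⊆ ((Finset.univ.erase ρ).image fun v => s(v, p v) : Finset (Sym2 V)) := by
    intro e
    induction e with
    | _ u v =>
      intro he
      obtain ⟨hne, he⟩ := (H.adj_iff u v).1 he
      simp only [Finset.coe_image, Set.mem_image, Finset.mem_coe, Finset.mem_erase,
        Finset.mem_univ, and_true]
      rcases he with he | he
      · exact ⟨u, fun hu => hne (by rw [← he, hu, H.parent_root]), by rw [he]⟩
      · exact ⟨v, fun hu => hne (by rw [← he, hu, H.parent_root]), by rw [he, Sym2.eq_swap]⟩
  have h1 := Set.ncard_le_ncard hsub (Finset.finite_toSet _)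
  rw [Set.ncard_coe_finset] at h1
  have h2 : ((Finset.univ.erase ρ).image fun v => s(v, p v)).card ≤ Fintype.card V - 1 := by
    refine Finset.card_image_le.trans ?_
    rw [Finset.card_erase_of_mem (Finset.mem_univ _), Finset.card_univ]
  have h3 : 0 < Fintype.card V := Fintype.card_pos_iff.2 ⟨ρ⟩
  rw [Nat.card_coe_set_eq, Nat.card_eq_fintype_card]
  omega

/-! ### Distances and the Wiener index through ancestor sets -/

theorem card_symmDiff_le_of_adj (H : G.IsRootedBy ρ p h) {u v : V} (huv : G.Adj u v) :
    (symmDiff (ancestors p u) (ancestors p v)).card ≤ 1 := by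
  have key : ∀ w : V, (symmDiff (ancestors p w) (ancestors p (p w))).card ≤ 1 := by
    intro w
    rw [ancestors_eq_insert w]
    refine (Finset.card_le_card (t := {w}) ?_).trans (by simp)
    intro x
    simp only [Finset.mem_symmDiff, Finset.mem_insert, Finset.mem_singleton]
    tauto
  rcases ((H.adj_iff u v).1 huv).2 with e | e
  · rw [← e]; exact key u
  · rw [← e, symmDiff_comm]; exact key v

theorem card_symmDiff_le_length (H : G.IsRootedBy ρ p h) {u v : V} (q : G.Walk u v) :
    (symmDiff (ancestors p u) (ancestors p v)).card ≤ q.length := by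
  induction q with
  | nil => simp
  | @cons u v w huv q ih =>
    rw [Walk.length_cons]
    have h1 := H.card_symmDiff_le_of_adj huv
    have h2 := Finset.card_le_card
      (symmDiff_triangle (ancestors p u) (ancestors p v) (ancestors p w))
    have h3 := Finset.card_union_le (symmDiff (ancestors p u) (ancestors p v))
      (symmDiff (ancestors p v) (ancestors p w))
    simp only [Finset.sup_eq_union] at h2
    omega

theorem card_symmDiff_parent (H : G.IsRootedBy ρ p h) {u w : V} (hu : u ≠ ρ)
    (hw : u ∉ ancestors p w) :
    (symmDiff (ancestors p u) (ancestors p w)).card =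
      (symmDiff (ancestors p (p u)) (ancestors p w)).card + 1 := by
  rw [← Finset.card_insert_of_notMem (a := u)]
  · congr 1
    rw [ancestors_eq_insert u]
    ext x
    simp only [Finset.mem_symmDiff, Finset.mem_insert]
    by_cases hx : x = u
    · subst hx; simp [hw]
    · simp [hx]
  · have := H.notMem_ancestors_parent hu
    simp [Finset.mem_symmDiff, this, hw]

/-- A vertex `v` in exactly one of the two ancestor sets stands for the edge from `v` to `p v`, and
these are the edges of the path from `u` to `w`. -/
theorem dist_eq (H : G.IsRootedBy ρ p h) (u w : V) :
    G.dist u w = (symmDiff (ancestors p u) (ancestors p w)).card := by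
  apply le_antisymm
  · induction hn : h u + h w using Nat.strong_induction_on generalizing u w with
    | _ n ih =>
      -- The vertex of larger height is not an ancestor of the other, so replacing it by its parent
      -- removes exactly one element of the symmetric difference.
      have step : ∀ a b : V, h a + h b = n → h b ≤ h a → a ≠ b →
          G.dist a b ≤ (symmDiff (ancestors p a) (ancestors p b)).card := by
        intro a b hab hle hne
        have hmem : a ∉ ancestors p b := fun hm =>
          absurd (H.height_lt_of_mem_ancestors hm hne.symm) (not_lt.2 hle)
        have ha : a ≠ ρ := fun e => hmem (e ▸ H.root_mem_ancestors b)
        rw [H.card_symmDiff_parent ha hmem]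
        have h1 := ih _ (by have := H.height_lt a ha; omega) (p a) b rfl
        have h2 := H.connected.dist_triangle (u := a) (v := p a) (w := b)
        rw [dist_eq_one_iff_adj.2 (H.adj_parent ha)] at h2
        omega
      by_cases huw : u = w
      · simp [huw]
      · rcases le_total (h w) (h u) with hle | hle
        · exact step u w hn hle huw
        · rw [dist_comm, symmDiff_comm]
          exact step w u (by omega) hle (Ne.symm huw)
  · obtain ⟨q, hq⟩ := H.connected.exists_walk_length_eq_dist u w
    rw [← hq]
    exact H.card_symmDiff_le_length q

theorem dist_parent_of_notMem (H : G.IsRootedBy ρ p h) {u w : V} (hu : u ≠ ρ)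
    (hw : u ∉ ancestors p w) : G.dist u w = G.dist (p u) w + 1 := by
  rw [H.dist_eq, H.dist_eq, H.card_symmDiff_parent hu hw]

theorem dist_parent_of_mem (H : G.IsRootedBy ρ p h) {u w : V} (hu : u ≠ ρ)
    (hw : u ∈ ancestors p w) : G.dist (p u) w = G.dist u w + 1 := by
  rw [H.dist_eq, H.dist_eq, ← Finset.card_insert_of_notMem (a := u)]
  · congr 1
    rw [ancestors_eq_insert u]
    have := H.notMem_ancestors_parent hu
    ext x
    simp only [Finset.mem_symmDiff, Finset.mem_insert]
    by_cases hx : x = u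
    · subst hx; simp [hw, this]
    · simp [hx]
  · simp [Finset.mem_symmDiff, hw, self_mem_ancestors]

/-- The edge above `v` lies on the path from `u` to `w` exactly when one of them is in the subtree
of `v`. The root has no such edge, and its term vanishes because its subtree is everything. -/
theorem wienerIndex_eq (H : G.IsRootedBy ρ p h) :
    wienerIndex G = ∑ v, (subtreeSize p v : ℝ) * (Fintype.card V - subtreeSize p v) := by
  have h1 : ∀ u w, (G.dist u w : ℝ) = ∑ v,
      ((if v ∈ ancestors p u then 1 else 0) * (1 - if v ∈ ancestors p w then 1 else 0) +
      (if v ∈ ancestors p w then 1 else 0) * (1 - if v ∈ ancestors p u then 1 else 0) : ℝ) := by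
    intro u w
    rw [H.dist_eq, ← Finset.filter_univ_mem (symmDiff (ancestors p u) (ancestors p w)),
      Finset.card_filter]
    push_cast
    refine Finset.sum_congr rfl fun v _ => ?_
    by_cases ha : v ∈ ancestors p u <;> by_cases hb : v ∈ ancestors p w <;>
      simp [Finset.mem_symmDiff, ha, hb]
  have h2 : ∀ v, (subtreeSize p v : ℝ) = ∑ u, if v ∈ ancestors p u then 1 else 0 := by
    intro v
    simp [subtreeSize]
  have h3 : ∀ v, ∑ u, ∑ w,
      ((if v ∈ ancestors p u then 1 else 0) * (1 - if v ∈ ancestors p w then 1 else 0) +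
      (if v ∈ ancestors p w then 1 else 0) * (1 - if v ∈ ancestors p u then 1 else 0) : ℝ) =
      2 * ((subtreeSize p v : ℝ) * (Fintype.card V - subtreeSize p v)) := by
    intro v
    simp only [Finset.sum_add_distrib, ← Finset.mul_sum, ← Finset.sum_mul,
      Finset.sum_sub_distrib, ← h2]
    simp
    ring
  simp only [wienerIndex, distanceMatrix, Matrix.of_apply, h1]
  have h4 : ∀ f : V → V → V → ℝ, ∑ u, ∑ w, ∑ v, f u w v = ∑ v, ∑ u, ∑ w, f u w v := by
    intro f
    rw [Finset.sum_comm (s := Finset.univ (α := V)) (f := fun v u => ∑ w, f u w v)]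
    exact Finset.sum_congr rfl fun u _ => Finset.sum_comm
  rw [h4]
  simp only [h3, ← Finset.mul_sum]
  ring

/-! ### Subtree sizes, medians and counting by parent iterates -/

theorem sum_dist_parent (H : G.IsRootedBy ρ p h) {u : V} (hu : u ≠ ρ) :
    ∑ w, G.dist u w + 2 * subtreeSize p u = ∑ w, G.dist (p u) w + Fintype.card V := by
  have h1 : ∀ w, G.dist u w + 2 * (if u ∈ ancestors p w then 1 else 0) =
      G.dist (p u) w + 1 := by
    intro w
    split_ifs with hw
    · rw [H.dist_parent_of_mem hu hw]
    · rw [H.dist_parent_of_notMem hu hw]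
  have h2 : subtreeSize p u = ∑ w, if u ∈ ancestors p w then 1 else 0 := by
    simp [subtreeSize]
  rw [h2, Finset.mul_sum, ← Finset.sum_add_distrib, Finset.sum_congr rfl fun w _ => h1 w,
    Finset.sum_add_distrib]
  simp

theorem subtreeSize_lt_parent (H : G.IsRootedBy ρ p h) {u : V} (hu : u ≠ ρ) :
    subtreeSize p u < subtreeSize p (p u) := by
  refine Finset.card_lt_card ((Finset.ssubset_iff_of_subset fun w => ?_).2 ⟨p u, ?_, ?_⟩)
  · simp only [Finset.mem_filter, Finset.mem_univ, true_and, mem_ancestors]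
    rintro ⟨k, rfl⟩
    exact ⟨k + 1, Function.iterate_succ_apply' _ _ _⟩
  · simp [self_mem_ancestors]
  · simpa using H.notMem_ancestors_parent hu

/-- For a child of the median, moving the base point across the edge cannot lower the distance sum.
Deeper subtrees are smaller still. -/
theorem two_mul_subtreeSize_le (H : G.IsRootedBy ρ p h)
    (hρ : ∀ v, ∑ w, G.dist ρ w ≤ ∑ w, G.dist v w) {u : V} (hu : u ≠ ρ) :
    2 * subtreeSize p u ≤ Fintype.card V := by
  induction hn : h u using Nat.strong_induction_on generalizing u with
  | _ n ih =>
    by_cases hp : p u = ρ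
    · have h1 := H.sum_dist_parent hu
      have h2 := hρ u
      rw [hp] at h1
      omega
    · have h1 := ih _ (hn ▸ H.height_lt u hu) hp rfl
      have h2 := H.subtreeSize_lt_parent hu
      omega

/-- Double counting of pairs `(u, v)` with `v ∉ A` an ancestor of `u`, written as `v = p^[k] u`. The
bound `N` is left free so that two trees can be compared over the same range of `k`. -/
theorem sum_subtreeSize_compl (H : G.IsRootedBy ρ p h) {A : Finset V} (hρ : ρ ∈ A) {N : ℕ} (hN : ∀ v, h v ≤ N) :
    ∑ v ∈ Aᶜ, subtreeSize p v =
      ∑ k ∈ Finset.range N, (Finset.univ.filter fun u => p^[k] u ∉ A).card := by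
  have h1 : ∀ u, (Aᶜ.filter fun v => v ∈ ancestors p u).card =
      ((Finset.range N).filter fun k => p^[k] u ∉ A).card := by
    intro u
    symm
    refine Finset.card_bij (fun k _ => p^[k] u) ?_ ?_ ?_
    · intro k hk
      simp only [Finset.mem_filter, Finset.mem_compl] at hk ⊢
      exact ⟨hk.2, mem_ancestors.2 ⟨k, rfl⟩⟩
    · have key : ∀ a b, a < b → p^[a] u ∉ A → p^[a] u ≠ p^[b] u := by
        intro a b hab ha e
        have hne : p^[a] u ≠ ρ := fun e => ha (e ▸ hρ)
        -- A repeated value would make the vertex `p^[a] u` an ancestor of its own parent.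
        apply H.notMem_ancestors_parent hne
        obtain ⟨c, rfl⟩ := Nat.exists_eq_add_of_lt hab
        refine mem_ancestors.2 ⟨c, ?_⟩
        rw [← Function.iterate_succ_apply' p a u, ← Function.iterate_add_apply]
        rw [show c + a.succ = a + c + 1 by omega, ← e]
      intro a ha b hb e
      simp only [Finset.mem_filter] at ha hb
      rcases lt_trichotomy a b with hab | hab | hab
      · exact absurd e (key a b hab ha.2)
      · exact hab
      · exact absurd e.symm (key b a hab hb.2)
    · intro v hv
      simp only [Finset.mem_filter, Finset.mem_compl] at hv
      obtain ⟨k, rfl⟩ := mem_ancestors.1 hv.2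
      refine ⟨k, ?_, rfl⟩
      simp only [Finset.mem_filter, Finset.mem_range]
      refine ⟨?_, hv.1⟩
      by_contra hk
      exact hv.1 (by rw [H.iterate_height k u ((hN u).trans (not_lt.1 hk))]; exact hρ)
  simp only [subtreeSize, Finset.card_filter] at h1 ⊢
  rw [Finset.sum_comm, Finset.sum_congr rfl fun u _ => h1 u, Finset.sum_comm]

theorem degree_eq (H : G.IsRootedBy ρ p h) (v : V) :
    G.degree v + (if v = ρ then 1 else 0) =
      (Finset.univ.filter fun u => u ≠ ρ ∧ p u = v).card + 1 := by
  by_cases hv : v = ρ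
  · subst hv
    rw [if_pos rfl, ← card_neighborFinset_eq_degree]
    congr 2
    ext u
    simp only [mem_neighborFinset, H.adj_iff, Finset.mem_filter, Finset.mem_univ, true_and,
      H.parent_root]
    grind
  · rw [if_neg hv, ← card_neighborFinset_eq_degree, add_zero,
      ← Finset.card_insert_of_notMem (a := p v)]
    · congr 1
      ext u
      have := H.adj_parent hv
      have h2 := H.parent_root
      have h3 := this.ne
      simp only [mem_neighborFinset, H.adj_iff, Finset.mem_filter, Finset.mem_univ, true_and,
        Finset.mem_insert]
      grind
    · simp only [Finset.mem_filter, Finset.mem_univ, true_and, not_and]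
      intro h1 h2
      have h3 := H.height_lt v hv
      have h4 := H.height_lt _ h1
      rw [h2] at h4
      omega

/-- Each vertex of `A` has one child fewer than its degree, except the root, which lacks a parent;
the root is moreover its own preimage. Together these account for the `2`. -/
theorem card_preimage_parent (H : G.IsRootedBy ρ p h) {A : Finset V} (hρ : ρ ∈ A) :
    (Finset.univ.filter fun u => p u ∈ A).card + A.card = ∑ v ∈ A, G.degree v + 2 := by
  have h1 : (Finset.univ.filter fun u => p u ∈ A) =
      insert ρ (Finset.univ.filter fun u => u ≠ ρ ∧ p u ∈ A) := by
    ext u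
    simp only [Finset.mem_filter, Finset.mem_univ, true_and, Finset.mem_insert]
    have := H.parent_root
    grind
  have h2 : (Finset.univ.filter fun u => u ≠ ρ ∧ p u ∈ A).card =
      ∑ v ∈ A, (Finset.univ.filter fun u => u ≠ ρ ∧ p u = v).card := by
    rw [Finset.card_eq_sum_card_fiberwise (f := p) (t := A)]
    · refine Finset.sum_congr rfl fun v hv => ?_
      congr 1
      ext u
      simp only [Finset.mem_filter, Finset.mem_univ, true_and]
      grind
    · intro u
      simp
  rw [h1, Finset.card_insert_of_notMem (by simp), h2]
  have h3 := Finset.sum_congr (rfl : A = A) fun v _ => H.degree_eq v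
  simp only [Finset.sum_add_distrib, Finset.sum_ite_eq', hρ, if_true, Finset.sum_const,
    smul_eq_mul, mul_one] at h3
  omega

end SimpleGraph.IsRootedBy

/-- Every tree is generated by the parent map of any chosen root. -/
theorem SimpleGraph.IsTree.exists_isRootedBy {V : Type*} [Fintype V] {G : SimpleGraph V}
    (hG : G.IsTree) (ρ : V) : ∃ p : V → V, G.IsRootedBy ρ p (G.dist ρ) := by
  classical
  have h1 : ∀ v, ∃ w, (v = ρ → w = ρ) ∧ (v ≠ ρ → G.Adj v w ∧ G.dist ρ w + 1 = G.dist ρ v) := by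
    intro v
    by_cases hv : v = ρ
    · exact ⟨ρ, fun _ => rfl, fun h => absurd hv h⟩
    · obtain ⟨q, hq⟩ := hG.connected.exists_walk_length_eq_dist v ρ
      cases q with
      | nil => exact absurd rfl hv
      | @cons _ w _ hvw q =>
        refine ⟨w, fun h => absurd h hv, fun _ => ⟨hvw, ?_⟩⟩
        rw [Walk.length_cons, dist_comm] at hq
        have h2 := dist_le q
        have h3 := hG.connected.dist_triangle (u := ρ) (v := w) (w := v)
        rw [dist_comm] at h2
        rw [dist_eq_one_iff_adj.2 hvw.symm] at h3
        omega
  choose p hp using h1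
  have hadj : ∀ v, v ≠ p v → G.Adj v (p v) := fun v hv =>
    ((hp v).2 fun e => hv (by rw [(hp v).1 e, e])).1
  have H : (fromRel fun u v => p u = v).IsRootedBy ρ p (G.dist ρ) :=
    ⟨(hp ρ).1 rfl, fun v hv => by have := ((hp v).2 hv).2; omega, fun u v => fromRel_adj _ _ _⟩
  have hle : (fromRel fun u v => p u = v) ≤ G := by
    intro u v huv
    obtain ⟨hne, rfl | rfl⟩ := (H.adj_iff u v).1 huv
    · exact hadj u hne
    · exact (hadj v hne.symm).symm
  -- A tree is minimal among connected graphs, so the connected subgraph of chosen parent edges is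
  -- all of `G`.
  have heq : G = fromRel fun u v => p u = v :=
    le_antisymm ((isTree_iff_minimal_connected.1 hG).2 H.connected hle) hle
  exact ⟨p, H.parent_root, H.height_lt, fun u v => by
    rw [← H.adj_iff, ← heq]⟩

/-! ### Tree degree sequences and sums of largest entries -/

/-- The properties of the degree sequence of a tree on which the BFS construction relies. -/
structure IsTreeSequence (d : List ℕ) : Prop where
  sorted : d.Pairwise (· ≤ ·)
  pos : 1 < d.length → ∀ x ∈ d, 0 < x
  sum_add_two : d.sum + 2 = 2 * d.length

theorem List.sum_take_succ_le_cons {a : ℕ} {l : List ℕ} (hl : (a :: l).Pairwise (· ≥ ·)) (k : ℕ) :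
    (l.take k).sum ≤ ((a :: l).take k).sum := by
  induction k generalizing a l with
  | zero => simp
  | succ k ih =>
    cases l with
    | nil => simp
    | cons b l =>
      have h1 : b ≤ a := (List.pairwise_cons.1 hl).1 b (by simp)
      have h2 := ih (List.pairwise_cons.1 hl).2
      simp only [List.take_succ_cons, List.sum_cons] at h2 ⊢
      omega

theorem List.Sublist.sum_le_sum_take {l' l : List ℕ} (h : l'.Sublist l)
    (hl : l.Pairwise (· ≥ ·)) : l'.sum ≤ (l.take l'.length).sum := by
  induction h with
  | slnil => simp
  | cons a h ih => exact (ih (List.pairwise_cons.1 hl).2).trans (List.sum_take_succ_le_cons hl _)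
  | cons_cons a h ih =>
    have := ih (List.pairwise_cons.1 hl).2
    simp only [List.length_cons, List.take_succ_cons, List.sum_cons]
    omega

theorem List.sum_take_eq_sum_range_getD (l : List ℕ) (k : ℕ) :
    (l.take k).sum = ∑ i ∈ Finset.range k, l.getD i 0 := by
  induction k with
  | zero => simp
  | succ k ih =>
    rw [Finset.sum_range_succ, ← ih]
    by_cases hk : k < l.length
    · rw [List.take_succ_eq_append_getElem hk, List.sum_append, List.getD_eq_getElem _ _ hk]
      simp
    · rw [List.getD_eq_default _ _ (not_lt.1 hk), List.take_of_length_le (by omega),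
        List.take_of_length_le (by omega), add_zero]

theorem Finset.sum_le_sum_range_getD {V : Type*} [Fintype V] (f : V → ℕ) {l : List ℕ}
    (hl : l.Pairwise (· ≥ ·)) (hf : (Finset.univ : Finset V).val.map f = l) (A : Finset V) :
    ∑ v ∈ A, f v ≤ ∑ i ∈ Finset.range A.card, l.getD i 0 := by
  have h1 : A.val.map f ≤ (l : Multiset ℕ) := by
    rw [← hf]
    exact Multiset.map_le_map (Finset.val_le_iff.2 (Finset.subset_univ A))
  rw [← List.sum_take_eq_sum_range_getD]
  obtain ⟨l', hl', hsub⟩ := Multiset.coe_le.1 (show ((A.val.map f).toList : Multiset ℕ) ≤ l by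
    rwa [Multiset.coe_toList])
  have h2 : (l' : Multiset ℕ) = A.val.map f := by
    rw [Multiset.coe_eq_coe.2 hl', Multiset.coe_toList]
  have h3 := hsub.sum_le_sum_take hl
  have h4 : l'.sum = ∑ v ∈ A, f v := by
    rw [← Multiset.sum_coe, h2]; rfl
  have h5 : l'.length = A.card := by
    rw [← Multiset.coe_card, h2, Multiset.card_map]; rfl
  rwa [h4, h5] at h3

/-! ### Structure of the BFS-tree -/

theorem bfsFirstChild_succ (d : List ℕ) (i : ℕ) :
    bfsFirstChild d (i + 1) = bfsFirstChild d i + bfsChildCount d i := by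
  rw [bfsFirstChild, Finset.sum_range_succ, bfsFirstChild, add_assoc]

theorem monotone_bfsFirstChild (d : List ℕ) : Monotone (bfsFirstChild d) :=
  monotone_nat_of_le_succ fun i => by rw [bfsFirstChild_succ]; omega

theorem one_le_bfsFirstChild (d : List ℕ) (i : ℕ) : 1 ≤ bfsFirstChild d i :=
  Nat.le_add_right _ _

/-- The parent of vertex `j` in the BFS-tree, and `0` for the root. -/
def bfsParent (d : List ℕ) (j : ℕ) : ℕ :=
  Nat.findGreatest (fun m => bfsFirstChild d m ≤ j) d.length

namespace IsTreeSequence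

variable {d : List ℕ} (hd : IsTreeSequence d)

include hd

theorem length_pos : 0 < d.length := by
  have := hd.sum_add_two
  omega

theorem sorted_reverse : d.reverse.Pairwise (· ≥ ·) := by
  rw [List.pairwise_reverse]
  exact hd.sorted

theorem getD_anti {i j : ℕ} (hij : i ≤ j) : d.reverse.getD j 0 ≤ d.reverse.getD i 0 := by
  by_cases hj : j < d.reverse.length
  · rw [List.getD_eq_getElem _ _ hj, List.getD_eq_getElem _ _ (hij.trans_lt hj)]
    rcases hij.eq_or_lt with rfl | h
    · exact le_rfl
    · exact List.pairwise_iff_getElem.1 hd.sorted_reverse _ _ _ hj h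
  · rw [List.getD_eq_default _ _ (not_lt.1 hj)]
    exact Nat.zero_le _

theorem getD_pos {i : ℕ} (h1 : 1 ≤ i) (hi : i < d.length) : 0 < d.reverse.getD i 0 := by
  have hi' : i < d.reverse.length := by simpa using hi
  rw [List.getD_eq_getElem _ _ hi']
  exact hd.pos (by omega) _ (List.mem_reverse.1 (List.getElem_mem hi'))

/-- This is the count of `card_preimage_parent` for the first `a` vertices. Positivity of the
degrees makes the truncated subtraction in `bfsChildCount` exact. -/
theorem bfsFirstChild_add {a : ℕ} (ha : 1 ≤ a) (han : a ≤ d.length) :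
    bfsFirstChild d a + a = ∑ i ∈ Finset.range a, d.reverse.getD i 0 + 2 := by
  induction a, ha using Nat.le_induction with
  | base => simp [bfsFirstChild, bfsChildCount]; omega
  | succ a ha ih =>
    have h1 := ih (by omega)
    have h2 := hd.getD_pos ha (by omega)
    rw [bfsFirstChild_succ, Finset.sum_range_succ, bfsChildCount, if_neg (by omega)]
    omega

theorem bfsFirstChild_length : bfsFirstChild d d.length = d.length := by
  have h1 := hd.bfsFirstChild_add hd.length_pos le_rfl
  rw [← List.sum_take_eq_sum_range_getD, List.take_of_length_le (by simp), List.sum_reverse,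
    hd.sum_add_two] at h1
  omega

theorem bfsFirstChild_le {a : ℕ} (ha : a ≤ d.length) : bfsFirstChild d a ≤ d.length :=
  (monotone_bfsFirstChild d ha).trans hd.bfsFirstChild_length.le

/-- Degrees descend along the numbering, so if `i` has a child, so does every earlier vertex, and
vertex `i` has itself been used before its children are placed. -/
theorem lt_bfsFirstChild {i : ℕ} (hi : 0 < bfsChildCount d i) : i < bfsFirstChild d i := by
  have h1 : ∀ k ∈ Finset.range i, 1 ≤ bfsChildCount d k := by
    intro k hk
    have h2 := hd.getD_anti (Finset.mem_range.1 hk).le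
    have h3 := Finset.mem_range.1 hk
    simp only [bfsChildCount] at hi ⊢
    rw [if_neg (by omega)] at hi
    split_ifs with h0
    · subst h0
      omega
    · omega
  have h2 := Finset.sum_le_sum h1
  simp only [Finset.sum_const, Finset.card_range, smul_eq_mul, mul_one] at h2
  rw [bfsFirstChild]
  omega

omit hd in
-- The vertices with parent in an initial segment again form an initial segment. The case `a = 0`
-- fails because vertex `0` gets parent `0` by the default value of `Nat.findGreatest`.
theorem bfsParent_lt_iff {j a : ℕ} (ha : 1 ≤ a) (han : a ≤ d.length) :
    bfsParent d j < a ↔ j < bfsFirstChild d a := by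
  constructor
  · intro h
    exact not_le.1 (Nat.findGreatest_is_greatest (P := fun m => bfsFirstChild d m ≤ j) h han)
  · intro h
    by_contra hc
    have h1 : bfsFirstChild d (bfsParent d j) ≤ j :=
      Nat.findGreatest_of_ne_zero (P := fun m => bfsFirstChild d m ≤ j) rfl
        (show bfsParent d j ≠ 0 by omega)
    have h2 := monotone_bfsFirstChild d (not_lt.1 hc)
    omega

theorem bfsParent_lt_length {j : ℕ} (hj : j < d.length) : bfsParent d j < d.length :=
  (bfsParent_lt_iff hd.length_pos le_rfl).2 (hd.bfsFirstChild_length.symm ▸ hj)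

omit hd in
theorem bfsParent_eq_iff {i j : ℕ} (hi : i < d.length) (hj : j ≠ 0) :
    bfsParent d j = i ↔ bfsFirstChild d i ≤ j ∧ j < bfsFirstChild d (i + 1) := by
  rw [← bfsParent_lt_iff (by omega) hi]
  rcases Nat.eq_zero_or_pos i with rfl | h
  · simp only [bfsFirstChild, Finset.range_zero, Finset.sum_empty]
    omega
  · rw [← not_lt, ← bfsParent_lt_iff h hi.le]
    omega

theorem bfsParent_lt {j : ℕ} (hj : j ≠ 0) (hjn : j < d.length) : bfsParent d j < j := by
  have h1 := (bfsParent_eq_iff (hd.bfsParent_lt_length hjn) hj).1 rfl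
  have h2 := hd.lt_bfsFirstChild (i := bfsParent d j) (by rw [bfsFirstChild_succ] at h1; omega)
  omega

theorem bfsParent_zero : bfsParent d 0 = 0 := by
  have := (bfsParent_lt_iff (j := 0) le_rfl hd.length_pos).2 (one_le_bfsFirstChild d 1)
  omega

theorem isRootedBy_bfsTree :
    (bfsTree d).IsRootedBy ⟨0, hd.length_pos⟩
      (fun j => ⟨bfsParent d j, hd.bfsParent_lt_length j.2⟩) (fun j => (j : ℕ)) where
  parent_root := Fin.ext hd.bfsParent_zero
  height_lt v hv := hd.bfsParent_lt (fun e => hv (Fin.ext e)) v.2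
  adj_iff u v := by
    have key : ∀ a b : Fin d.length, a ≠ b → (bfsParent d a = b ↔
        bfsFirstChild d b ≤ a ∧ (a : ℕ) < bfsFirstChild d (b + 1)) := by
      intro a b hab
      by_cases ha : (a : ℕ) = 0
      · have hb : (b : ℕ) ≠ 0 := fun e => hab (Fin.ext (ha.trans e.symm))
        rw [ha, hd.bfsParent_zero]
        have := one_le_bfsFirstChild d b
        omega
      · exact bfsParent_eq_iff b.2 ha
    simp only [bfsTree, SimpleGraph.fromRel_adj, Fin.ext_iff, ne_eq]
    refine and_congr_right fun hne => ?_
    have hne' : u ≠ v := fun e => hne (Fin.ext_iff.1 e)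
    rw [key u v hne', key v u hne'.symm, or_comm]

open Classical in
theorem degree_bfsTree (i : Fin d.length) : (bfsTree d).degree i = d.reverse.getD i 0 := by
  have h2 : (Finset.univ.filter fun u : Fin d.length => u ≠ ⟨0, hd.length_pos⟩ ∧
      (⟨bfsParent d u, hd.bfsParent_lt_length u.2⟩ : Fin d.length) = i).card =
      bfsChildCount d i := by
    have h3 : bfsChildCount d i =
        (Finset.Ico (bfsFirstChild d i) (bfsFirstChild d (i + 1))).card := by
      rw [Nat.card_Ico, bfsFirstChild_succ]
      omega
    rw [h3]
    refine Finset.card_bij (fun u _ => (u : ℕ)) ?_ (fun a _ b _ e => Fin.ext e) ?_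
    · intro u hu
      simp only [Finset.mem_filter, Finset.mem_univ, true_and, Fin.ext_iff, ne_eq] at hu
      exact Finset.mem_Ico.2 ((bfsParent_eq_iff i.2 hu.1).1 hu.2)
    · intro b hb
      have hb := Finset.mem_Ico.1 hb
      have hb0 : b ≠ 0 := by
        have := one_le_bfsFirstChild d i
        omega
      have hbn : b < d.length := hb.2.trans_le (hd.bfsFirstChild_le i.2)
      refine ⟨⟨b, hbn⟩, ?_, rfl⟩
      simp only [Finset.mem_filter, Finset.mem_univ, true_and, Fin.ext_iff, ne_eq]
      exact ⟨hb0, (bfsParent_eq_iff i.2 hb0).2 hb⟩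
  have h1 : (bfsTree d).degree i + (if i = ⟨0, hd.length_pos⟩ then 1 else 0) =
      bfsChildCount d i + 1 := by
    rw [← h2]
    convert hd.isRootedBy_bfsTree.degree_eq i
  simp only [Fin.ext_iff, bfsChildCount] at h1
  split_ifs at h1 with h0
  · rw [h0]
    omega
  · have := hd.getD_pos (i := i) (by omega) i.2
    omega

theorem degreeSequence_bfsTree : degreeSequence (bfsTree d) = d := by
  classical
  have h1 : (Finset.univ.val.map fun v => (bfsTree d).degree v) = (d : Multiset ℕ) := by
    have h2 : (fun v => (bfsTree d).degree v) = fun v : Fin d.length => d.get v.rev := by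
      funext v
      have hv : (v : ℕ) < d.reverse.length := by simp
      rw [hd.degree_bfsTree, List.getD_eq_getElem _ _ hv, List.getElem_reverse, List.get_eq_getElem]
      congr 1
      simp only [Fin.val_rev]
      omega
    rw [h2]
    have h3 : (Finset.univ.val.map fun v : Fin d.length => d.get v.rev) =
        Finset.univ.val.map d.get := by
      have h4 := congrArg Finset.val (Finset.map_univ_equiv (Fin.revPerm (n := d.length)))
      rw [Finset.map_val] at h4
      conv_rhs => rw [← h4, Multiset.map_map]
      rfl
    rw [h3, Fin.univ_val_map, List.ofFn_get]
  have h5 : degreeSequence (bfsTree d) =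
      (Finset.univ.val.map fun v => (bfsTree d).degree v).sort (· ≤ ·) := by
    unfold degreeSequence
    congr!
  rw [h5, h1, Multiset.coe_sort]
  exact List.mergeSort_of_pairwise (by simpa using hd.sorted)

/-! ### Comparison of subtree sizes with the BFS-tree -/

theorem bfsParent_iterate_lt_iff {r : ℕ} (hr : 1 ≤ r) (hrn : r ≤ d.length) (k : ℕ) :
    1 ≤ (bfsFirstChild d)^[k] r ∧ (bfsFirstChild d)^[k] r ≤ d.length ∧
      ∀ j, (bfsParent d)^[k] j < r ↔ j < (bfsFirstChild d)^[k] r := by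
  induction k with
  | zero => exact ⟨hr, hrn, fun j => Iff.rfl⟩
  | succ k ih =>
    obtain ⟨h1, h2, h3⟩ := ih
    rw [Function.iterate_succ_apply']
    refine ⟨one_le_bfsFirstChild d _, hd.bfsFirstChild_le h2, fun j => ?_⟩
    rw [Function.iterate_succ_apply, h3, bfsParent_lt_iff h1 h2]

open Classical in
-- Iterates the bound that a set of `b` vertices containing the root has degree sum at most that of
-- the `b` largest degrees, hence at most `bfsFirstChild d b` preimages under the parent map.
theorem card_iterate_mem_le {V : Type*} [Fintype V] {G : SimpleGraph V} {ρ : V} {p : V → V}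
    {h : V → ℕ} (H : G.IsRootedBy ρ p h) (hG : degreeSequence G = d) {A : Finset V} (hA : ρ ∈ A)
    (hcard : Fintype.card V = d.length) (k : ℕ) :
    (Finset.univ.filter fun u => p^[k] u ∈ A).card ≤ (bfsFirstChild d)^[k] A.card := by
  induction k with
  | zero => exact Finset.card_le_card fun u hu => (Finset.mem_filter.1 hu).2
  | succ k ih =>
    set B := Finset.univ.filter fun u => p^[k] u ∈ A
    have hB : ρ ∈ B := by simp [B, H.iterate_root, hA]
    have h1 : (Finset.univ.filter fun u => p^[k + 1] u ∈ A) =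
        Finset.univ.filter fun u => p u ∈ B := by
      ext u
      simp only [B, Finset.mem_filter, Finset.mem_univ, true_and]
      rfl
    rw [h1, Function.iterate_succ_apply']
    refine le_trans ?_ (monotone_bfsFirstChild d ih)
    have h2 := H.card_preimage_parent hB
    have h3 : B.card ≤ d.length := hcard ▸ Finset.card_le_univ B
    have h4 := hd.bfsFirstChild_add (Finset.card_pos.2 ⟨ρ, hB⟩) h3
    have h5 : (Finset.univ.val.map fun v => G.degree v) = (d.reverse : Multiset ℕ) := by
      rw [Multiset.coe_reverse, ← hG, degreeSequence, Multiset.sort_eq]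
    have h6 := Finset.sum_le_sum_range_getD (fun v => G.degree v) hd.sorted_reverse h5 B
    omega

open Classical in
/-- The subtree sizes outside any set containing the root have at least the sum
that they have in the BFS-tree. -/
theorem sum_subtreeSize_le {V : Type*} [Fintype V] {G : SimpleGraph V} {ρ : V} {p : V → V}
    {h : V → ℕ} (H : G.IsRootedBy ρ p h) (hG : degreeSequence G = d) {A : Finset V} (hA : ρ ∈ A)
    (hcard : Fintype.card V = d.length) :
    ∑ j ∈ Finset.univ.filter (fun j : Fin d.length => A.card ≤ (j : ℕ)),
      subtreeSize (fun j : Fin d.length =>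
        (⟨bfsParent d j, hd.bfsParent_lt_length j.2⟩ : Fin d.length)) j ≤
      ∑ v ∈ Aᶜ, subtreeSize p v := by
  set q : Fin d.length → Fin d.length :=
    fun j => ⟨bfsParent d j, hd.bfsParent_lt_length j.2⟩ with hq
  have hr : 1 ≤ A.card := Finset.card_pos.2 ⟨ρ, hA⟩
  have hrn : A.card ≤ d.length := hcard ▸ Finset.card_le_univ A
  set B : Finset (Fin d.length) := Finset.univ.filter fun j => (j : ℕ) < A.card with hB
  have h1 : (Finset.univ.filter fun j : Fin d.length => A.card ≤ (j : ℕ)) = Bᶜ := by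
    ext j
    simp [hB]
  -- Bounds the heights in both trees; in the BFS-tree the height of a vertex is its number.
  set N := d.length + Finset.univ.sup h
  have hB0 : (⟨0, hd.length_pos⟩ : Fin d.length) ∈ B := by
    simp only [hB, Finset.mem_filter, Finset.mem_univ, true_and]
    omega
  have h2 : ∑ j ∈ Bᶜ, subtreeSize q j = ∑ k ∈ Finset.range N,
      (Finset.univ.filter fun u : Fin d.length => q^[k] u ∉ B).card := by
    convert hd.isRootedBy_bfsTree.sum_subtreeSize_compl hB0 (N := N) (fun v => by omega)
  rw [h1, h2,
    H.sum_subtreeSize_compl hA (N := N)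
      (fun v => le_add_left (Finset.le_sup (f := h) (Finset.mem_univ v)))]
  refine Finset.sum_le_sum fun k _ => ?_
  obtain ⟨_, h3, h4⟩ := hd.bfsParent_iterate_lt_iff hr hrn k
  have hval : ∀ u : Fin d.length, ((q^[k] u : Fin d.length) : ℕ) = (bfsParent d)^[k] u := by
    intro u
    have hsemi : Function.Semiconj (fun j : Fin d.length => (j : ℕ)) q (bfsParent d) :=
      fun j => rfl
    exact (hsemi.iterate_right k) u
  have h5 : (Finset.univ.filter fun u : Fin d.length => q^[k] u ∈ B).card =
      (bfsFirstChild d)^[k] A.card := by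
    rw [← Nat.card_Iio ((bfsFirstChild d)^[k] A.card)]
    refine Finset.card_bij (fun u _ => (u : ℕ)) ?_ (fun a _ b _ e => Fin.ext e) ?_
    · intro u hu
      simp only [hB, Finset.mem_filter, Finset.mem_univ, true_and, hval] at hu
      exact Finset.mem_Iio.2 ((h4 u).1 hu)
    · intro b hb
      have hb := Finset.mem_Iio.1 hb
      refine ⟨⟨b, hb.trans_le h3⟩, ?_, rfl⟩
      simp only [hB, Finset.mem_filter, Finset.mem_univ, true_and, hval]
      exact (h4 b).2 hb
  have h6 := hd.card_iterate_mem_le H hG hA hcard k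
  have h7 := Finset.card_filter_add_card_filter_not (s := (Finset.univ : Finset V))
    (fun u => p^[k] u ∈ A)
  have h8 := Finset.card_filter_add_card_filter_not
    (s := (Finset.univ : Finset (Fin d.length))) (fun u => q^[k] u ∈ B)
  rw [Finset.card_univ] at h7 h8
  rw [Fintype.card_fin] at h8
  omega

end IsTreeSequence

theorem SimpleGraph.IsTree.isTreeSequence {V : Type*} [Fintype V] {G : SimpleGraph V}
    (hG : G.IsTree) : IsTreeSequence (degreeSequence G) ∧
      Fintype.card V = (degreeSequence G).length := by
  classical
  have h0 : ((degreeSequence G : List ℕ) : Multiset ℕ) =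
      Finset.univ.val.map fun v => G.degree v := by
    rw [degreeSequence, Multiset.sort_eq]
  have h1 : Fintype.card V = (degreeSequence G).length := by
    rw [← Multiset.coe_card, h0, Multiset.card_map]
    rfl
  refine ⟨⟨Multiset.pairwise_sort _ _, fun hlen x hx => ?_, ?_⟩, h1⟩
  · rw [← Multiset.mem_coe, h0, Multiset.mem_map] at hx
    obtain ⟨v, _, rfl⟩ := hx
    have : Nontrivial V := Fintype.one_lt_card_iff_nontrivial.1 (h1 ▸ hlen)
    exact hG.connected.preconnected.degree_pos_of_nontrivial v
  · obtain ⟨ρ⟩ := hG.connected.nonempty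
    obtain ⟨p, H⟩ := hG.exists_isRootedBy ρ
    have h2 := H.card_preimage_parent (Finset.mem_univ ρ)
    have h3 : (degreeSequence G).sum = ∑ v, G.degree v := by
      rw [← Multiset.sum_coe, h0]
      rfl
    simp only [Finset.mem_univ, Finset.filter_true, Finset.card_univ] at h2
    omega

/-! ### Summation by parts and minimality of the Wiener index -/

/-- Summation by parts for monotone weights and nonnegative tail sums. -/
theorem mul_sum_tail_le {n : ℕ} (w δ : Fin n → ℝ) {r₀ : ℕ}
    (hw : ∀ i j : Fin n, r₀ ≤ (i : ℕ) → i ≤ j → w i ≤ w j)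
    (hδ : ∀ r, r₀ ≤ r → 0 ≤ ∑ i ∈ Finset.univ.filter (fun i : Fin n => r ≤ (i : ℕ)), δ i)
    {r : ℕ} (hr : r₀ ≤ r) {c : ℝ} (hc : ∀ i : Fin n, r ≤ (i : ℕ) → c ≤ w i) :
    c * ∑ i ∈ Finset.univ.filter (fun i : Fin n => r ≤ (i : ℕ)), δ i ≤
      ∑ i ∈ Finset.univ.filter (fun i : Fin n => r ≤ (i : ℕ)), w i * δ i := by
  induction hk : n - r generalizing r c with
  | zero =>
    have : Finset.univ.filter (fun i : Fin n => r ≤ (i : ℕ)) = ∅ := by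
      ext i
      simp only [Finset.mem_filter, Finset.mem_univ, true_and, Finset.notMem_empty, iff_false]
      omega
    simp [this]
  | succ k ih =>
    have hrn : r < n := by omega
    have hins : Finset.univ.filter (fun i : Fin n => r ≤ (i : ℕ)) =
        insert ⟨r, hrn⟩ (Finset.univ.filter fun i : Fin n => r + 1 ≤ (i : ℕ)) := by
      ext i
      simp only [Finset.mem_filter, Finset.mem_univ, true_and, Finset.mem_insert, Fin.ext_iff]
      omega
    have hmem : (⟨r, hrn⟩ : Fin n) ∉ Finset.univ.filter fun i : Fin n => r + 1 ≤ (i : ℕ) := by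
      simp
    -- The weight at `r` is a lower bound for all later weights, so it serves as the constant for
    -- the shorter tail.
    have h1 := ih (r := r + 1) (by omega) (c := w ⟨r, hrn⟩)
      (fun i hi => hw _ _ hr (Fin.le_def.2 (show r ≤ (i : ℕ) by omega))) (by omega)
    have h2 := mul_le_mul_of_nonneg_right (hc ⟨r, hrn⟩ le_rfl) (hδ r hr)
    refine h2.trans ?_
    rw [hins, Finset.sum_insert hmem, Finset.sum_insert hmem]
    linarith

theorem subtreeSize_root {V : Type*} [Fintype V] {G : SimpleGraph V} {ρ : V} {p : V → V}
    {h : V → ℕ} (H : G.IsRootedBy ρ p h) : subtreeSize p ρ = Fintype.card V := by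
  simp [subtreeSize, H.root_mem_ancestors]

/-- A vertex of maximal subtree size must be the root, since the parent of any other vertex has a
strictly larger subtree. -/
theorem exists_equiv_subtreeSize_anti {V : Type*} [Fintype V] {G : SimpleGraph V} {ρ : V}
    {p : V → V} {h : V → ℕ} (H : G.IsRootedBy ρ p h) {n : ℕ} (hn : Fintype.card V = n)
    (hpos : 0 < n) : ∃ e : Fin n ≃ V, e ⟨0, hpos⟩ = ρ ∧
      ∀ i j, i ≤ j → subtreeSize p (e j) ≤ subtreeSize p (e i) := by
  set e₀ : Fin n ≃ V := (Fintype.equivFinOfCardEq hn).symm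
  set f : Fin n → ℤ := fun i => -(subtreeSize p (e₀ i) : ℤ) with hf
  have hanti : ∀ i j, i ≤ j → subtreeSize p (((Tuple.sort f).trans e₀) j) ≤
      subtreeSize p (((Tuple.sort f).trans e₀) i) := by
    intro i j hij
    have := Tuple.monotone_sort f hij
    simp only [hf, Function.comp_apply, neg_le_neg_iff, Nat.cast_le] at this
    exact this
  refine ⟨(Tuple.sort f).trans e₀, ?_, hanti⟩
  by_contra hne
  have h1 := H.subtreeSize_lt_parent hne
  have h2 := hanti ⟨0, hpos⟩ (((Tuple.sort f).trans e₀).symm (p (((Tuple.sort f).trans e₀)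
    ⟨0, hpos⟩))) (Fin.le_def.2 (Nat.zero_le _))
  rw [Equiv.apply_symm_apply] at h2
  omega

/-- Among the trees with a given degree sequence, the BFS-tree minimizes the Wiener index. -/
theorem SimpleGraph.IsTree.wienerIndex_bfsTree_le {V : Type*} [Fintype V] {G : SimpleGraph V}
    (hG : G.IsTree) {d : List ℕ} (hGd : degreeSequence G = d) :
    wienerIndex (bfsTree d) ≤ wienerIndex G := by
  classical
  obtain ⟨hd, hcard⟩ := hG.isTreeSequence
  rw [hGd] at hd hcard
  have := hG.connected.nonempty
  -- The root is a median; this is what makes the weights `n - 2x` nonnegative below.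
  obtain ⟨ρ, hρ⟩ := Finite.exists_min fun v => ∑ w, G.dist v w
  obtain ⟨p, H⟩ := hG.exists_isRootedBy ρ
  obtain ⟨e, he0, he⟩ := exists_equiv_subtreeSize_anti H hcard hd.length_pos
  set z : Fin d.length := ⟨0, hd.length_pos⟩ with hz
  set q : Fin d.length → Fin d.length :=
    fun j => ⟨bfsParent d j, hd.bfsParent_lt_length j.2⟩ with hq
  set x : Fin d.length → ℝ := fun i => subtreeSize p (e i)
  set y : Fin d.length → ℝ := fun i => subtreeSize q i
  have hx0 : x z = d.length := by
    simp only [x, he0, subtreeSize_root H, hcard]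
  have hy0 : y z = d.length := by
    simp only [y, subtreeSize_root hd.isRootedBy_bfsTree, Fintype.card_fin, hz, hq]
  have htail : ∀ r, 1 ≤ r → 0 ≤
      ∑ i ∈ Finset.univ.filter (fun i : Fin d.length => r ≤ (i : ℕ)), (x i - y i) := by
    intro r hr
    by_cases hrn : d.length < r
    · refine Finset.sum_nonneg fun i hi => ?_
      have := (Finset.mem_filter.1 hi).2
      omega
    set B : Finset (Fin d.length) := Finset.univ.filter fun i => (i : ℕ) < r with hB
    have hBc : Finset.univ.filter (fun i : Fin d.length => r ≤ (i : ℕ)) = Bᶜ := by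
      ext i
      simp [hB]
    have hBcard : (B.map e.toEmbedding).card = r := by
      rw [Finset.card_map, hB, Fin.card_filter_val_lt]
      omega
    have hmem : ρ ∈ B.map e.toEmbedding := by
      rw [Finset.mem_map]
      refine ⟨z, ?_, he0⟩
      simp only [hB, hz, Finset.mem_filter, Finset.mem_univ, true_and]
      omega
    have h1 := hd.sum_subtreeSize_le H hGd hmem hcard
    rw [hBcard, hBc] at h1
    have h2 : ∑ v ∈ (B.map e.toEmbedding)ᶜ, subtreeSize p v = ∑ i ∈ Bᶜ, subtreeSize p (e i) := by
      refine Eq.trans ?_ (Finset.sum_map Bᶜ e.toEmbedding (fun v => subtreeSize p v))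
      refine Finset.sum_congr ?_ fun _ _ => rfl
      ext v
      simp [Finset.mem_map_equiv]
    have h3 : ∑ i ∈ Bᶜ, subtreeSize q i ≤ ∑ i ∈ Bᶜ, subtreeSize p (e i) := by
      rw [← h2]
      convert h1
    rw [hBc, Finset.sum_sub_distrib, sub_nonneg]
    simp only [x, y]
    exact_mod_cast h3
  have hhalf : ∀ i : Fin d.length, 1 ≤ (i : ℕ) → 0 ≤ d.length - 2 * x i := by
    intro i hi
    have hne : e i ≠ ρ := by
      rw [← he0]
      intro h
      have := congrArg Fin.val (e.injective h)
      simp only [hz] at this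
      omega
    have := H.two_mul_subtreeSize_le hρ hne
    rw [hcard] at this
    simp only [x, sub_nonneg]
    exact_mod_cast this
  -- Only `x` has to be sorted: the weights involve `x` alone. The root is left out, since its
  -- weight is `-n`.
  have habel := mul_sum_tail_le (fun i => d.length - 2 * x i) (fun i => x i - y i) (r₀ := 1)
    (fun i j _ hij => by
      have : x j ≤ x i := Nat.cast_le.2 (he i j hij)
      linarith) htail le_rfl hhalf
  rw [zero_mul] at habel
  rw [hd.isRootedBy_bfsTree.wienerIndex_eq, H.wienerIndex_eq, ← Equiv.sum_comp e, ← sub_nonneg,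
    ← Finset.sum_sub_distrib, Fintype.card_fin, hcard]
  have hsplit : (Finset.univ : Finset (Fin d.length)) =
      insert z (Finset.univ.filter fun i : Fin d.length => 1 ≤ (i : ℕ)) := by
    ext i
    simp only [Finset.mem_filter, Finset.mem_univ, true_and, Finset.mem_insert, Fin.ext_iff,
      true_iff]
    have hz0 : (z : ℕ) = 0 := rfl
    omega
  rw [hsplit, Finset.sum_insert (by simp [hz])]
  have h0 : x z * (d.length - x z) - y z * (d.length - y z) = 0 := by
    rw [hx0, hy0]
    ring
  have hrest : 0 ≤ ∑ i ∈ Finset.univ.filter (fun i : Fin d.length => 1 ≤ (i : ℕ)),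
      (x i * (d.length - x i) - y i * (d.length - y i)) := by
    refine habel.trans (Finset.sum_le_sum fun i _ => ?_)
    -- The two sides differ by exactly `(x i - y i)^2`.
    nlinarith [sq_nonneg (x i - y i)]
  exact add_nonneg h0.ge hrest

/-! ### The distance spectral radius: Rayleigh bound and isomorphism invariance -/

theorem isHermitian_distanceMatrix {V : Type*} (G : SimpleGraph V) :
    (distanceMatrix G).IsHermitian := by
  ext u v
  simp [distanceMatrix, SimpleGraph.dist_comm]

/-- The Rayleigh quotient of the distance matrix at the all-ones vector bounds its
spectral radius from below. -/
theorem two_div_mul_wienerIndex_le {V : Type*} [Fintype V] [Nonempty V] (G : SimpleGraph V) :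
    2 / (Fintype.card V : ℝ) * wienerIndex G ≤ distanceSpectralRadius G := by
  classical
  set μ := distanceSpectralRadius G
  set A := distanceMatrix G with hA
  have hM : (μ • (1 : Matrix V V ℝ) - A).IsHermitian := by
    refine Matrix.IsHermitian.sub ?_ (isHermitian_distanceMatrix G)
    simp [Matrix.IsHermitian]
  -- If `ν` is an eigenvalue of `μ • 1 - A`, then `μ - ν` is one of `A`, hence at most `μ`.
  have hpsd : (μ • (1 : Matrix V V ℝ) - A).PosSemidef := by
    rw [hM.posSemidef_iff_eigenvalues_nonneg]
    intro i
    have h1 := hM.mulVec_eigenvectorBasis i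
    have h2 : Module.End.HasEigenvalue A.mulVecLin (μ - hM.eigenvalues i) := by
      refine Module.End.hasEigenvalue_of_hasEigenvector
        (x := (hM.eigenvectorBasis i).ofLp) ⟨?_, ?_⟩
      · rw [Module.End.mem_eigenspace_iff, Matrix.mulVecLin_apply, sub_smul, ← h1,
          Matrix.sub_mulVec, Matrix.smul_mulVec, Matrix.one_mulVec]
        abel
      · intro h
        apply hM.eigenvectorBasis.orthonormal.ne_zero i
        ext j
        exact congrFun h j
    have h3 := (isGreatest_distanceSpectralRadius G).2 h2
    simp only [Pi.zero_apply]
    linarith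
  have h4 := hpsd.dotProduct_mulVec_nonneg fun _ => 1
  have h5 : star (fun _ : V => (1 : ℝ)) ⬝ᵥ (μ • (1 : Matrix V V ℝ) - A).mulVec (fun _ => 1) =
      μ * Fintype.card V - 2 * wienerIndex G := by
    rw [Matrix.sub_mulVec, Matrix.smul_mulVec, Matrix.one_mulVec]
    simp [dotProduct, Matrix.mulVec, wienerIndex, Finset.sum_sub_distrib, ← hA]
    ring
  rw [h5] at h4
  have h6 : (0 : ℝ) < Fintype.card V := Nat.cast_pos.2 Fintype.card_pos
  rw [div_mul_eq_mul_div, div_le_iff₀ h6]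
  linarith

theorem SimpleGraph.Iso.dist_eq {V W : Type*} {G : SimpleGraph V} {G' : SimpleGraph W}
    (f : G ≃g G') (hG : G.Connected) (u v : V) : G'.dist (f u) (f v) = G.dist u v := by
  apply le_antisymm
  · obtain ⟨q, hq⟩ := hG.exists_walk_length_eq_dist u v
    rw [← hq, ← Walk.length_map f.toHom q]
    exact dist_le _
  · obtain ⟨q, hq⟩ := (f.connected_iff.1 hG).exists_walk_length_eq_dist (f u) (f v)
    rw [← hq, ← Walk.length_map f.symm.toHom q]
    have := dist_le (q.map f.symm.toHom)
    simpa using this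

theorem distanceSpectralRadius_congr {V W : Type*} [Fintype V] [Fintype W] {G : SimpleGraph V}
    {G' : SimpleGraph W} (f : G ≃g G') (hG : G.Connected) :
    distanceSpectralRadius G = distanceSpectralRadius G' := by
  have key : ∀ μ : ℝ, Module.End.HasEigenvalue (distanceMatrix G).mulVecLin μ ↔
      Module.End.HasEigenvalue (distanceMatrix G').mulVecLin μ := by
    have h1 : ∀ x : W → ℝ, (distanceMatrix G).mulVec (x ∘ f) =
        (distanceMatrix G').mulVec x ∘ f := by
      intro x
      funext u
      simp only [Matrix.mulVec, dotProduct, distanceMatrix, Matrix.of_apply, Function.comp_apply]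
      rw [← Equiv.sum_comp f.toEquiv]
      refine Finset.sum_congr rfl fun v _ => ?_
      rw [← f.dist_eq hG]
      rfl
    intro μ
    constructor
    · intro h
      obtain ⟨x, hx, hx0⟩ := h.exists_hasEigenvector
      rw [Module.End.mem_eigenspace_iff, Matrix.mulVecLin_apply] at hx
      have hxf : x = (x ∘ f.symm) ∘ f := by
        funext u
        simp
      refine Module.End.hasEigenvalue_of_hasEigenvector (x := x ∘ f.symm) ⟨?_, fun h0 => hx0 ?_⟩
      · rw [Module.End.mem_eigenspace_iff, Matrix.mulVecLin_apply]
        rw [hxf, h1] at hx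
        funext w
        have := congrFun hx (f.symm w)
        simpa using this
      · rw [hxf, h0]
        rfl
    · intro h
      obtain ⟨x, hx, hx0⟩ := h.exists_hasEigenvector
      rw [Module.End.mem_eigenspace_iff, Matrix.mulVecLin_apply] at hx
      refine Module.End.hasEigenvalue_of_hasEigenvector (x := x ∘ f) ⟨?_, fun h0 => hx0 ?_⟩
      · rw [Module.End.mem_eigenspace_iff, Matrix.mulVecLin_apply, h1, hx]
        rfl
      · funext w
        simpa using congrFun h0 (f.symm w)
  simp only [distanceSpectralRadius, key]

theorem degreeSequence_congr {V W : Type*} [Fintype V] [Fintype W] {G : SimpleGraph V}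
    {G' : SimpleGraph W} (f : G ≃g G') : degreeSequence G = degreeSequence G' := by
  classical
  unfold degreeSequence
  congr 1
  rw [← Finset.map_univ_equiv f.toEquiv, Finset.map_val, Multiset.map_map]
  refine Multiset.map_congr rfl fun v _ => ?_
  exact (f.degree_eq v).symm

/-! ### The main theorem -/

theorem mainTheorem2 {V : Type*} [Fintype V] (d : List ℕ)
    (hd : (treesWithDegreeSequence V d).Nonempty) :
    (∃ T ∈ treesWithDegreeSequence V d, ∀ T' ∈ treesWithDegreeSequence V d,
      distanceSpectralRadius T ≤ distanceSpectralRadius T') ∧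
    ∀ T ∈ treesWithDegreeSequence V d,
      (∀ T' ∈ treesWithDegreeSequence V d,
        distanceSpectralRadius T ≤ distanceSpectralRadius T') →
      2 / (d.length : ℝ) * wienerIndex (bfsTree d) ≤ distanceSpectralRadius T ∧
      distanceSpectralRadius T ≤ distanceSpectralRadius (bfsTree d) := by
  classical
  refine ⟨Set.exists_min_image _ _ (Set.toFinite _) hd, ?_⟩
  rintro T ⟨hT, hTd⟩ hmin
  obtain ⟨hseq, hcard⟩ := hT.isTreeSequence
  rw [hTd] at hseq hcard
  have := hT.connected.nonempty
  constructor
  · have hray := two_div_mul_wienerIndex_le T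
    rw [hcard] at hray
    refine le_trans ?_ hray
    exact mul_le_mul_of_nonneg_left (hT.wienerIndex_bfsTree_le hTd) (by positivity)
  · let e : Fin d.length ≃ V := (Fintype.equivFinOfCardEq hcard).symm
    -- The BFS-tree lives on `Fin d.length`; it is transported to `V` to compete with `T`.
    let f : bfsTree d ≃g (bfsTree d).map e.toEmbedding := SimpleGraph.Iso.map e (bfsTree d)
    have hB := hseq.isRootedBy_bfsTree.isTree
    rw [distanceSpectralRadius_congr f hB.connected]
    exact hmin _ ⟨f.isTree_iff.1 hB, by
      rw [← degreeSequence_congr f, hseq.degreeSequence_bfsTree]⟩
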